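/- Let $I$ be an arbitrary index set, $\bar{\mathbb R}=[-\infty,\infty]$, and let $\mathcal P(\bar{\mathbb R}^I)$ be the set of probability measures on $\bar{\mathbb R}^I$ with the product $\sigma$-algebra $\bigotimes_{i\in I}\mathcal B(\bar{\mathbb R})$. For $\mu\in\mathcal P(\bar{\mathbb R}^I)$, let $\mu_J$ be its image on $\bar{\mathbb R}^J$ ($J\subseteq I$ finite) and $\mu_i$ its one-dimensional marginals. For a probability measure $\rho$ on $\bar{\mathbb R}^J$, $J$ finite, put $F_\rho(x)=\rho(\{y: y_j\le x_j \ \forall j\in J\})$ for $x\in\bar{\mathbb R}^J$ (and $F_\rho(x)=\rho([-\infty,x])$ for $\rho$ on $\bar{\mathbb R}$); for a probability measure $\rho$ on $\bar{\mathbb R}$ put $F_{\rho}^{[-1]}(u)=\inf\{x\in(-\infty,\infty): F_\rho(x)\ge u\}\in\bar{\mathbb R}$. Each $\mathcal P(\bar{\mathbb R}^J)$, $J$ finite, and $\mathcal P(\bar{\mathbb R})$ carries the topology of weak convergence. The set $\varprojlim\mathcal P(\bar{\mathbb R}^J)\subseteq\prod_{J}\mathcal P(\bar{\mathbb R}^J)$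 of consistent families indexed by the finite $J\subseteq I$ carries the subspace topology of the product topology, and $\mathcal P(\bar{\mathbb R}^I)$ carries the topology of weak convergence of finite-dimensional distributions, i.e. the one induced by the natural map $\mu\mapsto(\mu_J)_J$ into $\varprojlim\mathcal P(\bar{\mathbb R}^J)$; this map is a homeomorphism onto $\varprojlim\mathcal P(\bar{\mathbb R}^J)$. A copula measure is a $C\in\mathcal P(\bar{\mathbb R}^I)$ all of whose marginals $C_i$ are uniformly distributed on $[0,1]$; the set $\mathcal C(\bar{\mathbb R}^I)$ of copula measures carries the subspace topology. For $C\in\mathcal C(\bar{\mathbb R}^I)$, a family $\nu=(\nu_i)_{i\in I}$ of Borel probability measures on $\bar{\mathbb R}$ and $\mu\in\mathcal P(\bar{\mathbb R}^I)$, the Sklar identity for $(C,\nu,\mu)$ is $$F_{C_J}\big((F_{\nu_j}(x_j))_{j\in J}\big)=F_{\mu_J}\big((x_j)_{j\in J}\big)\qquad\text{for all finite } J\subseteq I \text{ and all } (x_j)_{j\in J}\in\bar{\mathbb R}^J.$$ Then: (1) $\mathcal P(\bar{\mathbb R}^I)$ is a Hausdorff space. (2) $\mathcal C(\bar{\mathbb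 R}^I)$ is compact. (3) For every $C\in\mathcal C(\bar{\mathbb R}^I)$ and every family $\nu=(\nu_i)_{i\in I}$ of Borel probability measures on $\bar{\mathbb R}$, the push-forward $\mu:=((F_{\nu_i}^{[-1]})_{i\in I})_*C$ has marginals $\mu_i=\nu_i$, and $(C,\nu,\mu)$ satisfies the Sklar identity. (4) The map $\Phi:\mathcal C(\bar{\mathbb R}^I)\times\prod_{i\in I}\mathcal P(\bar{\mathbb R})\to\mathcal P(\bar{\mathbb R}^I)$, $\Phi(C,(\nu_i)_{i\in I})=((F_{\nu_i}^{[-1]})_{i\in I})_*C$, is continuous (for the product topology on its domain) and surjective. In particular, Sklar's theorem holds: for every $\mu\in\mathcal P(\bar{\mathbb R}^I)$ there is a copula measure $C$ such that $(C,(\mu_i)_{i\in I},\mu)$ satisfies the Sklar identity, and $C$ is unique if for every $i\in I$ the function $F_{\mu_i}$ is continuous on $\bar{\mathbb R}$ with $F_{\mu_i}(-\infty)=0$; conversely, for every $C\in\mathcal C(\bar{\mathbb R}^I)$ and every family $\nu=(\nu_i)_{i\in I}$ of Borel probability measures on $\bar{\mathbb R}$ there is a unique $\mu\in\mathcal P(\bar{\mathbb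 R}^I)$ such that $(C,\nu,\mu)$ satisfies the Sklar identity. -/

import Mathlib

open MeasureTheory Set

noncomputable section

/-- The set of all probability measures on the product space `[-∞,∞]^I` with the product
`σ`-algebra, for an arbitrary index set `I`. -/
def Law (I : Type*) : Type _ := ProbabilityMeasure (I → EReal)

/-- The distribution function `x ↦ μ {y | y ≤ x}` of a probability measure `μ` on an ordered
space; it is used for `[-∞,∞]` and for `[-∞,∞]^J` with `J` finite (coordinatewise order). -/
def distFun {E : Type*} [Preorder E] [MeasurableSpace E] (μ : ProbabilityMeasure E) (x : E) : ℝ :=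
  (μ : Measure E).real (Iic x)

/-- The quantile function `u ↦ inf {x ∈ (-∞,∞) | F_μ(x) ≥ u}`, the infimum being taken in
`[-∞,∞]`. -/
def quantile (μ : ProbabilityMeasure EReal) (u : EReal) : EReal :=
  sInf ((fun x : ℝ => (x : EReal)) '' {x : ℝ | u ≤ (distFun μ (x : EReal) : EReal)})

theorem quantile_monotone (μ : ProbabilityMeasure EReal) : Monotone (quantile μ) := by
  intro u v huv
  exact sInf_le_sInf (image_mono fun x hx => huv.trans hx)

theorem quantile_measurable (μ : ProbabilityMeasure EReal) : Measurable (quantile μ) :=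
  (quantile_monotone μ).measurable

theorem quantileMap_measurable {I : Type*} (ν : I → ProbabilityMeasure EReal) :
    Measurable (fun (u : I → EReal) (i : I) => quantile (ν i) (u i)) :=
  measurable_pi_lambda _ fun i => (quantile_measurable (ν i)).comp (measurable_pi_apply i)

/-- Projection of a law on `[-∞,∞]^{J₂}` to the coordinates in `J₁ ⊆ J₂`. -/
def projFin {I : Type*} {J₁ J₂ : Finset I} (h : J₁ ⊆ J₂) (μ : ProbabilityMeasure (J₂ → EReal)) :
    ProbabilityMeasure (J₁ → EReal) :=
  μ.map (Finset.measurable_restrict₂ (X := fun _ : I => EReal) h).aemeasurable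

/-- The inverse limit of the spaces of probability measures on `[-∞,∞]^J`, `J ⊆ I` finite, each
with the topology of weak convergence: the consistent families, with the subspace topology of the
product topology. -/
abbrev ConsistentFamily (I : Type*) : Type _ :=
  {p : (J : Finset I) → ProbabilityMeasure (J → EReal) //
    ∀ (J₁ J₂ : Finset I) (h : J₁ ⊆ J₂), projFin h (p J₂) = p J₁}

namespace Law

variable {I : Type*}

/-- The finite-dimensional distribution `μ_J`. -/
def fdd (μ : Law I) (J : Finset I) : ProbabilityMeasure (J → EReal) :=
  ProbabilityMeasure.map (Ω := I → EReal) μ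
    (Finset.measurable_restrict (X := fun _ : I => EReal) J).aemeasurable

/-- The one-dimensional marginal `μ_i`. -/
def marginal (μ : Law I) (i : I) : ProbabilityMeasure EReal :=
  ProbabilityMeasure.map (Ω := I → EReal) μ (measurable_pi_apply i).aemeasurable

theorem projFin_fdd (μ : Law I) (J₁ J₂ : Finset I) (h : J₁ ⊆ J₂) :
    projFin h (μ.fdd J₂) = μ.fdd J₁ := by
  apply Subtype.ext
  exact Measure.map_map (Finset.measurable_restrict₂ (X := fun _ : I => EReal) h)
    (Finset.measurable_restrict (X := fun _ : I => EReal) J₂)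

/-- The natural map from laws to consistent families. -/
def toConsistentFamily (μ : Law I) : ConsistentFamily I :=
  ⟨fun J => μ.fdd J, fun J₁ J₂ h => μ.projFin_fdd J₁ J₂ h⟩

/-- The topology of weak convergence of the finite-dimensional distributions, transported from
the inverse limit along the natural map. -/
instance : TopologicalSpace (Law I) :=
  TopologicalSpace.induced toConsistentFamily inferInstance

end Law

/-- The uniform distribution on `[0,1]`, as a measure on `[-∞,∞]`. -/
def uniformUnit : Measure EReal :=
  ((volume : Measure ℝ).restrict (Icc 0 1)).map (fun x : ℝ => (x : EReal))

/-- A copula measure: all one-dimensional marginals are uniform on `[0,1]`. -/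
def IsCopula {I : Type*} (C : Law I) : Prop :=
  ∀ i, (C.marginal i : Measure EReal) = uniformUnit

/-- The space of copula measures on `[-∞,∞]^I`, with the subspace topology. -/
abbrev Copula (I : Type*) : Type _ := {C : Law I // IsCopula C}

/-- The push-forward `((F_{ν_i}^{[-1]})_{i ∈ I})_* C`. -/
def quantilePush {I : Type*} (C : Law I) (ν : I → ProbabilityMeasure EReal) : Law I :=
  ProbabilityMeasure.map (Ω := I → EReal) C (quantileMap_measurable ν).aemeasurable

/-- The map `Φ`. -/
def sklarMap (I : Type*) (p : Copula I × (I → ProbabilityMeasure EReal)) : Law I :=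
  quantilePush p.1.1 p.2

/-- The Sklar identity `F_{C_J}((F_{ν_j}(x_j))_{j ∈ J}) = F_{μ_J}((x_j)_{j ∈ J})` for all finite
`J ⊆ I` and all `x ∈ [-∞,∞]^J`. -/
def SklarIdentity {I : Type*} (C : Law I) (ν : I → ProbabilityMeasure EReal) (μ : Law I) : Prop :=
  ∀ (J : Finset I) (x : J → EReal),
    distFun (C.fdd J) (fun j => (distFun (ν j) (x j) : EReal)) = distFun (μ.fdd J) x

end

/-! Everything rests on the Galois connection `quantile_le_iff`: for `u ≤ 1`, the quantile of `u` is
at most `x` iff `u ≤ F(x)`. Under a copula measure it turns the events defining the distribution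
functions of `quantilePush C ν` into events `u j ≤ F_j (x j)`, which is the Sklar identity.
Finite-dimensional distribution functions determine a law, so the triples satisfying the identity
form exactly the graph of `sklarMap`.

Continuity is then a closed graph argument: `Law I` is compact Hausdorff, and
`SklarIdentity.of_tendsto` shows that the identity survives limits. It combines convergence at
continuity points with the Lipschitz bound for copula distribution functions, which is uniform in
the copula. Compactness comes from the inverse limit, a closed subspace of a product of compact
spaces, identified with `Law I` by Kolmogorov extension.

For surjectivity each coordinate is replaced by its distributional transform, which spreads every
atom over its jump interval by means of an independent uniform variable. One such variable serves
all coordinates, since only the marginals must be uniform. Both sides of the Sklar identity then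
describe almost surely equal events (`Law.ae_distTransform_le_iff`). -/

open Filter Topology

/-! ### Distribution functions and the quantile Galois connection. -/

section DistFun

variable {E : Type*} [MeasurableSpace E]

theorem distFun_nonneg [Preorder E] (μ : ProbabilityMeasure E) (x : E) : 0 ≤ distFun μ x :=
  measureReal_nonneg

theorem distFun_le_one [Preorder E] (μ : ProbabilityMeasure E) (x : E) : distFun μ x ≤ 1 :=
  measureReal_le_one

theorem distFun_mono [Preorder E] (μ : ProbabilityMeasure E) : Monotone (distFun μ) :=
  fun _ _ h => measureReal_mono (Iic_subset_Iic.2 h)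

theorem distFun_top [Preorder E] [OrderTop E] (μ : ProbabilityMeasure E) : distFun μ ⊤ = 1 := by
  simp [distFun]

/-- Distribution functions are continuous from above. -/
theorem tendsto_distFun_of_le [PartialOrder E] [TopologicalSpace E] [OrderClosedTopology E]
    [OpensMeasurableSpace E] (μ : ProbabilityMeasure E) {ι : Type*} {l : Filter ι}
    [l.IsCountablyGenerated] {y : ι → E} {x : E} (hy : Tendsto y l (𝓝 x)) (hle : ∀ i, x ≤ y i) :
    Tendsto (fun i => distFun μ (y i)) l (𝓝 (distFun μ x)) := by
  refine (ENNReal.tendsto_toReal (measure_ne_top _ _)).comp ?_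
  refine tendsto_measure_of_tendsto_indicator_of_isFiniteMeasure l (μ := (μ : Measure E))
    (As := fun i => Iic (y i)) (A := Iic x) (fun i => measurableSet_Iic) ?_
  intro z
  by_cases hz : z ≤ x
  · exact Eventually.of_forall fun i => by simp [hz, hz.trans (hle i)]
  · have : ∀ᶠ w in 𝓝 x, ¬ z ≤ w := (isClosed_Ici (a := z)).isOpen_compl.mem_nhds hz
    filter_upwards [hy.eventually this] with i hi
    simp [hz, hi]

/-- A probability measure on a finite power of `[-∞,∞]` is determined by its distribution
function. -/
theorem ProbabilityMeasure.ext_of_distFun_pi {J : Type*} [Finite J]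
    {μ ν : ProbabilityMeasure (J → EReal)} (h : ∀ x, distFun μ x = distFun ν x) : μ = ν := by
  apply ProbabilityMeasure.toMeasure_injective
  have hgen : MeasurableSpace.pi = MeasurableSpace.generateFrom
      (pi univ '' pi univ fun _ : J => range (Iic : EReal → Set EReal)) := by
    refine (generateFrom_eq_pi (fun _ => ?_) fun _ => ?_).symm
    · rw [← borel_eq_generateFrom_Iic, BorelSpace.measurable_eq (α := EReal)]
    · exact ⟨fun _ => univ, fun _ => ⟨⊤, Iic_top⟩, iUnion_const _⟩
  refine ext_of_generate_finite _ hgen (IsPiSystem.pi fun _ => isPiSystem_Iic) ?_ ?_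
  · rintro _ ⟨s, hs, rfl⟩
    choose x hx using fun j => hs j (mem_univ j)
    have : pi univ s = Iic x := by rw [← pi_univ_Iic]; simp only [hx]
    rw [this]
    exact (ENNReal.toReal_eq_toReal_iff' (measure_ne_top _ _) (measure_ne_top _ _)).1 (h x)
  · simp

theorem ProbabilityMeasure.ext_of_distFun {μ ν : ProbabilityMeasure EReal}
    (h : ∀ x, distFun μ x = distFun ν x) : μ = ν := by
  apply ProbabilityMeasure.toMeasure_injective
  exact Measure.ext_of_Iic _ _ fun x =>
    (ENNReal.toReal_eq_toReal_iff' (measure_ne_top _ _) (measure_ne_top _ _)).1 (h x)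

end DistFun

/-- The Galois connection between the quantile function and the distribution function. -/
theorem quantile_le_iff (ν : ProbabilityMeasure EReal) {u : EReal} (hu : u ≤ 1) (x : EReal) :
    quantile ν u ≤ x ↔ u ≤ (distFun ν x : EReal) := by
  constructor
  · intro h
    rcases eq_top_or_lt_top x with rfl | hx
    -- At `⊤` nothing lies to the right; here `F = 1`, and `u ≤ 1` is what is needed.
    · simpa [distFun_top] using hu
    · obtain ⟨y, -, hy, hlim⟩ := exists_seq_strictAnti_tendsto' hx
      have := (continuous_coe_real_ereal.tendsto _).comp
        (tendsto_distFun_of_le ν hlim fun n => (hy n).1.le)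
      refine ge_of_tendsto' this fun n => ?_
      -- The infimum need not be attained in `ℝ`, so a real witness is taken below each `y n`; right
      -- continuity then brings the bound down to `x`.
      obtain ⟨_, ⟨z, hz, rfl⟩, hzy⟩ := sInf_lt_iff.1 (h.trans_lt (hy n).1)
      exact hz.out.trans (EReal.coe_le_coe_iff.2 (distFun_mono ν hzy.le))
  · intro h
    refine EReal.le_of_forall_lt_iff_le.1 fun z hz => sInf_le ⟨z, ?_, rfl⟩
    exact h.trans (EReal.coe_le_coe_iff.2 (distFun_mono ν hz.le))

/-! ### The uniform distribution and basic facts on laws. -/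

section UniformUnit

/-- Lebesgue measure on `[0,1]`. -/
noncomputable abbrev unitMeasure : Measure ℝ := volume.restrict (Icc 0 1)

instance : IsProbabilityMeasure unitMeasure :=
  ⟨by simp⟩

instance : IsProbabilityMeasure uniformUnit :=
  Measure.isProbabilityMeasure_map measurable_coe_real_ereal.aemeasurable

theorem uniformUnit_apply {s : Set EReal} (hs : MeasurableSet s) :
    uniformUnit s = (volume : Measure ℝ) ((fun x : ℝ => (x : EReal)) ⁻¹' s ∩ Icc 0 1) := by
  rw [uniformUnit, Measure.map_apply measurable_coe_real_ereal hs,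
    Measure.restrict_apply (measurable_coe_real_ereal hs)]

theorem uniformUnit_Ioc_le (a b : ℝ) :
    uniformUnit (Ioc (a : EReal) b) ≤ ENNReal.ofReal (b - a) := by
  rw [uniformUnit_apply measurableSet_Ioc, ← Real.volume_Ioc]
  refine measure_mono fun x hx => ?_
  simpa using hx.1

theorem uniformUnit_real_Iic {t : ℝ} (h0 : 0 ≤ t) (h1 : t ≤ 1) :
    uniformUnit.real (Iic (t : EReal)) = t := by
  have : (fun x : ℝ => (x : EReal)) ⁻¹' Iic (t : EReal) ∩ Icc 0 1 = Icc 0 t := by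
    ext x
    simp only [mem_inter_iff, mem_preimage, mem_Iic, EReal.coe_le_coe_iff, mem_Icc]
    exact ⟨fun h => ⟨h.2.1, h.1⟩, fun h => ⟨h.2, h.1, h.2.trans h1⟩⟩
  rw [Measure.real, uniformUnit_apply measurableSet_Iic, this, Real.volume_Icc, sub_zero,
    ENNReal.toReal_ofReal h0]

instance : NullSingletonClass uniformUnit where
  measure_singleton x := by
    rw [uniformUnit_apply (measurableSet_singleton x)]
    refine measure_mono_null inter_subset_left (Set.Subsingleton.measure_zero ?_ _)
    intro a ha b hb
    exact EReal.coe_injective (ha.trans hb.symm)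

theorem ae_uniformUnit_mem_Ioc : ∀ᵐ u ∂uniformUnit, u ∈ Ioc (0 : EReal) 1 := by
  have h : uniformUnit.real (Iic 1) = 1 := by
    simpa using uniformUnit_real_Iic (t := 1) zero_le_one le_rfl
  have h0 : uniformUnit.real (Iic 0) = 0 := by
    simpa using uniformUnit_real_Iic (t := 0) le_rfl zero_le_one
  have h1 : ∀ᵐ u ∂uniformUnit, u ∈ Iic (1 : EReal) := by
    refine (mem_ae_iff_prob_eq_one measurableSet_Iic).2 ?_
    simpa [Measure.real, ENNReal.toReal_eq_one_iff] using h
  have h2 : ∀ᵐ u ∂uniformUnit, u ∉ Iic (0 : EReal) :=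
    measure_eq_zero_iff_ae_notMem.1 ((measureReal_eq_zero_iff).1 h0)
  filter_upwards [h1, h2] with u hu hu'
  exact ⟨not_le.1 hu', hu⟩

end UniformUnit

theorem measurableSet_forall_le {I : Type*} {J : Finset I} (x : J → EReal) :
    MeasurableSet {y : I → EReal | ∀ j : J, y j ≤ x j} := by
  rw [ofPred_forall]
  exact MeasurableSet.iInter fun j => measurableSet_le (measurable_pi_apply _) measurable_const

namespace Law

variable {I : Type*}

/-- The underlying measure of a law. -/
def toMeasure (μ : Law I) : Measure (I → EReal) := Subtype.val μ

instance (μ : Law I) : IsProbabilityMeasure μ.toMeasure := μ.2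

theorem toMeasure_fdd (μ : Law I) (J : Finset I) :
    (μ.fdd J : Measure (J → EReal)) = μ.toMeasure.map J.restrict := rfl

theorem toMeasure_marginal (μ : Law I) (i : I) :
    (μ.marginal i : Measure EReal) = μ.toMeasure.map fun y => y i := rfl

theorem distFun_fdd (μ : Law I) (J : Finset I) (x : J → EReal) :
    distFun (μ.fdd J) x = μ.toMeasure.real {y | ∀ j : J, y j ≤ x j} := by
  rw [distFun, toMeasure_fdd, map_measureReal_apply (Finset.measurable_restrict J)
    measurableSet_Iic]
  rfl

theorem distFun_marginal (μ : Law I) (i : I) (x : EReal) :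
    distFun (μ.marginal i) x = μ.toMeasure.real {y | y i ≤ x} := by
  rw [distFun, toMeasure_marginal, map_measureReal_apply (measurable_pi_apply i)
    measurableSet_Iic]
  rfl

theorem ext_of_distFun {μ ν : Law I}
    (h : ∀ (J : Finset I) (x : J → EReal), distFun (μ.fdd J) x = distFun (ν.fdd J) x) :
    μ = ν := by
  apply Subtype.ext
  refine IsProjectiveLimit.unique (P := fun J => (μ.fdd J : Measure (J → EReal)))
    (fun J => rfl) (fun J => ?_)
  exact congrArg Subtype.val (ProbabilityMeasure.ext_of_distFun_pi (h J)).symm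

/-- A copula measure sits on `(0,1]` in every coordinate. -/
theorem ae_mem_Ioc {C : Law I} (hC : IsCopula C) (i : I) :
    ∀ᵐ u ∂C.toMeasure, u i ∈ Ioc (0 : EReal) 1 := by
  have := ae_uniformUnit_mem_Ioc
  rw [← hC i, toMeasure_marginal] at this
  exact ae_of_ae_map (measurable_pi_apply i).aemeasurable this

theorem ae_forall_mem_Ioc {C : Law I} (hC : IsCopula C) (J : Finset I) :
    ∀ᵐ u ∂C.toMeasure, ∀ j : J, u j ∈ Ioc (0 : EReal) 1 :=
  ae_all_iff.2 fun j => ae_mem_Ioc hC j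

end Law

/-! ### The push-forward under quantile functions. -/

section QuantilePush

variable {I : Type*}

theorem toMeasure_quantilePush (C : Law I) (ν : I → ProbabilityMeasure EReal) :
    (quantilePush C ν).toMeasure = C.toMeasure.map fun u i => quantile (ν i) (u i) := rfl

theorem sklarIdentity_quantilePush {C : Law I} (hC : IsCopula C)
    (ν : I → ProbabilityMeasure EReal) : SklarIdentity C ν (quantilePush C ν) := by
  intro J x
  rw [Law.distFun_fdd, Law.distFun_fdd, toMeasure_quantilePush,
    map_measureReal_apply (quantileMap_measurable ν)
      (measurableSet_forall_le x)]
  refine measureReal_congr ?_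
  filter_upwards [Law.ae_forall_mem_Ioc hC J] with u hu
  exact propext (forall_congr' fun j => (quantile_le_iff (ν j) (hu j).2 (x j)).symm)

/-- The Sklar identity determines the law from the copula measure and the marginals. -/
theorem SklarIdentity.eq_quantilePush {C : Law I} (hC : IsCopula C)
    {ν : I → ProbabilityMeasure EReal} {μ : Law I} (h : SklarIdentity C ν μ) :
    μ = quantilePush C ν :=
  Law.ext_of_distFun fun J x => (h J x).symm.trans (sklarIdentity_quantilePush hC ν J x)

theorem marginal_quantilePush {C : Law I} (hC : IsCopula C)
    (ν : I → ProbabilityMeasure EReal) (i : I) : (quantilePush C ν).marginal i = ν i := by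
  refine ProbabilityMeasure.ext_of_distFun fun x => ?_
  have hmeas : MeasurableSet {y : I → EReal | y i ≤ x} :=
    measurableSet_le (measurable_pi_apply _) measurable_const
  rw [Law.distFun_marginal, toMeasure_quantilePush,
    map_measureReal_apply (quantileMap_measurable ν) hmeas,
    ← uniformUnit_real_Iic (distFun_nonneg (ν i) x) (distFun_le_one (ν i) x), ← hC i,
    Law.toMeasure_marginal, map_measureReal_apply (measurable_pi_apply i) measurableSet_Iic]
  refine measureReal_congr ?_
  filter_upwards [Law.ae_mem_Ioc hC i] with u hu
  exact propext (quantile_le_iff (ν i) hu.2 x)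

end QuantilePush

/-! ### Uniqueness of the copula for continuous marginals. -/

section Uniqueness

variable {I : Type*}

/-- Intermediate value theorem: `F` runs continuously from `0` at `⊥` to `1` at `⊤`. -/
theorem exists_distFun_eq {ν : ProbabilityMeasure EReal} (hν : Continuous (distFun ν))
    (h0 : distFun ν ⊥ = 0) (u : EReal) :
    ∃ x, (distFun ν x : EReal) = max 0 (min u 1) := by
  have hu0 : (0 : EReal) ≤ max 0 (min u 1) := le_max_left _ _
  have hu1 : max 0 (min u 1) ≤ (1 : EReal) := max_le zero_le_one (min_le_right _ _)
  lift max 0 (min u 1) to ℝ using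
    ⟨(hu1.trans_lt (EReal.coe_lt_top 1)).ne, ((EReal.bot_lt_coe 0).trans_le hu0).ne'⟩ with t
  obtain ⟨x, hx⟩ := mem_range_of_exists_le_of_exists_ge (c := t) hν
    ⟨⊥, by rw [h0]; exact_mod_cast hu0⟩ ⟨⊤, by rw [distFun_top]; exact_mod_cast hu1⟩
  exact ⟨x, by rw [hx]⟩

/-- A copula measure lives on `(0,1]` in each coordinate, where clamping the bound to `[0,1]` does
not change the event. Hence its distribution function is determined by its values on `[0,1]^J`. -/
theorem IsCopula.distFun_clamp {C : Law I} (hC : IsCopula C) (J : Finset I) (u : J → EReal) :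
    distFun (C.fdd J) (fun j => max 0 (min (u j) 1)) = distFun (C.fdd J) u := by
  rw [Law.distFun_fdd, Law.distFun_fdd]
  refine measureReal_congr ?_
  filter_upwards [Law.ae_forall_mem_Ioc hC J] with y hy
  refine propext (forall_congr' fun j => ?_)
  have := hy j
  simp [not_le.2 this.1, this.2]

/-- The copula measure is determined by the law if the marginal distribution functions are
continuous. -/
theorem SklarIdentity.copula_unique {C C' : Law I} (hC : IsCopula C) (hC' : IsCopula C')
    {ν : I → ProbabilityMeasure EReal} {μ : Law I} (h : SklarIdentity C ν μ)
    (h' : SklarIdentity C' ν μ)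
    (hν : ∀ i, Continuous (distFun (ν i)) ∧ distFun (ν i) ⊥ = 0) : C = C' := by
  refine Law.ext_of_distFun fun J u => ?_
  choose x hx using fun j : J => exists_distFun_eq (hν j).1 (hν j).2 (u j)
  rw [← hC.distFun_clamp, ← hC'.distFun_clamp]
  simp only [← hx]
  rw [h J x, h' J x]

end Uniqueness

/-! ### Inverse limit, Kolmogorov extension and compactness. -/

section Topology

variable {I : Type*}

theorem continuous_projFin {J₁ J₂ : Finset I} (h : J₁ ⊆ J₂) : Continuous (projFin h) :=
  ProbabilityMeasure.continuous_map
    (continuous_pi fun j : J₁ => continuous_apply (⟨j, h j.2⟩ : J₂))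

theorem isClosed_consistent (I : Type*) :
    IsClosed {p : (J : Finset I) → ProbabilityMeasure (J → EReal) |
      ∀ (J₁ J₂ : Finset I) (h : J₁ ⊆ J₂), projFin h (p J₂) = p J₁} := by
  simp only [ofPred_forall]
  exact isClosed_iInter fun J₁ => isClosed_iInter fun J₂ => isClosed_iInter fun h =>
    isClosed_eq ((continuous_projFin h).comp (continuous_apply J₂)) (continuous_apply J₁)

/-- Each factor consists of probability measures on a compact space and is compact; Tychonoff
applies, and consistency is a closed condition. -/
instance : CompactSpace (ConsistentFamily I) :=
  (isClosed_consistent I).isClosedEmbedding_subtypeVal.compactSpace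

/-- A family of probability measures that is consistent along continuous sections `e` and
projections `r` of a compact space is the family of images of one probability measure: a cluster
point of the images under `e`. -/
theorem exists_probabilityMeasure_map_eq {X ι : Type*} [TopologicalSpace X] [CompactSpace X]
    [T2Space X] [MeasurableSpace X] [BorelSpace X] [Preorder ι] [IsDirectedOrder ι] [Nonempty ι]
    {Y : ι → Type*} [∀ j, TopologicalSpace (Y j)] [∀ j, MeasurableSpace (Y j)]
    [∀ j, BorelSpace (Y j)] [∀ j, HasOuterApproxClosed (Y j)]
    (p : ∀ j, ProbabilityMeasure (Y j)) {r : ∀ j, X → Y j} (hr : ∀ j, Continuous (r j))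
    {e : ∀ j, Y j → X} (he : ∀ j, Continuous (e j))
    (h : ∀ j k, j ≤ k → (p k : Measure (Y k)).map (r j ∘ e k) = p j) :
    ∃ m : ProbabilityMeasure X, ∀ j, (m : Measure X).map (r j) = p j := by
  obtain ⟨m, hm⟩ := exists_clusterPt_of_compactSpace
    (map (fun k => (p k).map (he k).measurable.aemeasurable) atTop)
  refine ⟨m, fun j => ?_⟩
  have hc : MapClusterPt (m.map (hr j).measurable.aemeasurable) atTop
      ((fun ν : ProbabilityMeasure X => ν.map (hr j).measurable.aemeasurable) ∘
        fun k => (p k).map (he k).measurable.aemeasurable) :=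
    MapClusterPt.continuousAt_comp (ProbabilityMeasure.continuous_map (hr j)).continuousAt hm
  have hlim : Tendsto ((fun ν : ProbabilityMeasure X => ν.map (hr j).measurable.aemeasurable) ∘
      fun k => (p k).map (he k).measurable.aemeasurable) atTop (𝓝 (p j)) := by
    -- By consistency the images under `r j` equal `p j` for every index `k ≥ j`, so their cluster
    -- point must be `p j`.
    refine tendsto_const_nhds.congr' ?_
    filter_upwards [eventually_ge_atTop j] with k hk
    apply ProbabilityMeasure.toMeasure_injective
    rw [← h j k hk]
    exact (Measure.map_map (hr j).measurable (he k).measurable).symm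
  exact congrArg ProbabilityMeasure.toMeasure (eq_of_nhds_neBot (hc.neBot.mono
    (inf_le_inf_left _ hlim)))

namespace Law

theorem toConsistentFamily_injective :
    Function.Injective (toConsistentFamily : Law I → ConsistentFamily I) := by
  intro μ ν h
  refine ext_of_distFun fun J x => ?_
  have : μ.fdd J = ν.fdd J := congrFun (congrArg Subtype.val h) J
  rw [this]

/-- Kolmogorov's extension theorem for `[-∞,∞]^I`. -/
theorem toConsistentFamily_surjective :
    Function.Surjective (toConsistentFamily : Law I → ConsistentFamily I) := by
  classical
  rintro ⟨p, hp⟩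
  -- Continuous section of the restriction map; the filler value `0` is arbitrary.
  let e (J : Finset I) (y : J → EReal) (i : I) : EReal := if h : i ∈ J then y ⟨i, h⟩ else 0
  have he (J : Finset I) : Continuous (e J) := by
    refine continuous_pi fun i => ?_
    by_cases h : i ∈ J
    · simpa [e, h] using continuous_apply (⟨i, h⟩ : J)
    · simpa [e, h] using continuous_const
  have hr (J : Finset I) : Continuous (J.restrict : (I → EReal) → J → EReal) :=
    continuous_pi fun j => continuous_apply (j : I)
  have hre (J K : Finset I) (h : J ≤ K) :
      (p K : Measure (K → EReal)).map (J.restrict ∘ e K) = p J := by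
    rw [← hp J K h]
    change _ = Measure.map (Finset.restrict₂ (π := fun _ => EReal) h) _
    congr 1
    funext y j
    simp [e, h j.2]
  -- The compactness argument produces a measure on the Borel `σ`-algebra, which for uncountable `I`
  -- is larger than the product one. Pushing it along `id` restricts it.
  obtain ⟨m, hm⟩ := @exists_probabilityMeasure_map_eq (I → EReal) (Finset I) _ _ _
    (borel _) (@BorelSpace.mk _ _ (borel _) rfl) _ _ _ _ _ _ _ _ p _ hr _ he hre
  have hid : @Measurable _ _ (borel (I → EReal)) _ (id : (I → EReal) → I → EReal) :=
    fun s hs => pi_le_borel_pi (X := fun _ : I => EReal)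
      s (by convert hs)
  let μ : Law I := @ProbabilityMeasure.map _ _ (borel _) _ m id
    (@Measurable.aemeasurable _ _ (borel _) _ _ _ hid)
  refine ⟨μ, Subtype.ext (funext fun J => ProbabilityMeasure.toMeasure_injective ?_)⟩
  rw [← hm J]
  exact @Measure.map_map _ _ _ (borel _) _ _ _ _ _ (Finset.measurable_restrict J) hid

theorem isHomeomorph_toConsistentFamily :
    IsHomeomorph (toConsistentFamily : Law I → ConsistentFamily I) :=
  ((Equiv.ofBijective _ ⟨toConsistentFamily_injective,
    toConsistentFamily_surjective⟩).toHomeomorphOfIsInducing ⟨rfl⟩).isHomeomorph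

instance : T2Space (Law I) :=
  (isHomeomorph_toConsistentFamily (I := I)).homeomorph.symm.t2Space

instance : CompactSpace (Law I) :=
  (isHomeomorph_toConsistentFamily (I := I)).homeomorph.symm.compactSpace

theorem continuous_fdd (J : Finset I) : Continuous fun μ : Law I => μ.fdd J :=
  (continuous_apply J).comp (continuous_subtype_val.comp
    (continuous_induced_dom (f := toConsistentFamily)))

theorem continuous_marginal (i : I) : Continuous fun μ : Law I => μ.marginal i :=
  (ProbabilityMeasure.continuous_map (continuous_apply (⟨i, by simp⟩ : ({i} : Finset I)))).comp
    (continuous_fdd {i}) |>.congr fun μ => ProbabilityMeasure.toMeasure_injective <|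
      Measure.map_map (measurable_pi_apply _) (Finset.measurable_restrict _)

end Law

instance : CompactSpace (Copula I) := by
  have : IsClosed {C : Law I | IsCopula C} := by
    have h : {C : Law I | IsCopula C} = ⋂ i, {C | C.marginal i = ⟨uniformUnit, inferInstance⟩} := by
      ext C
      simp only [mem_iInter, mem_ofPred_eq]
      exact forall_congr' fun i => (Subtype.ext_iff (a1 := C.marginal i)
        (a2 := ⟨uniformUnit, inferInstance⟩)).symm
    rw [h]
    exact isClosed_iInter fun i => isClosed_eq (Law.continuous_marginal i) continuous_const
  exact this.isClosedEmbedding_subtypeVal.compactSpace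

end Topology

/-! ### Existence of a copula by the distributional transform. -/

section Existence

/-- The distributional transform `F_ν(x-) + v (F_ν(x) - F_ν(x-))`. -/
noncomputable def distTransform (ν : ProbabilityMeasure EReal) (p : EReal × ℝ) : ℝ :=
  (1 - p.2) * (ν : Measure EReal).real (Iio p.1) + p.2 * distFun ν p.1

theorem distTransform_measurable (ν : ProbabilityMeasure EReal) :
    Measurable (distTransform ν) := by
  have h1 : Monotone fun x => (ν : Measure EReal).real (Iio x) :=
    fun _ _ h => measureReal_mono (Iio_subset_Iio h)
  have h2 := (distFun_mono ν).measurable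
  have h3 := h1.measurable
  exact ((measurable_const.sub measurable_snd).mul (h3.comp measurable_fst)).add
    (measurable_snd.mul (h2.comp measurable_fst))

theorem measureReal_Iio_le_distFun (ν : ProbabilityMeasure EReal) (x : EReal) :
    (ν : Measure EReal).real (Iio x) ≤ distFun ν x :=
  measureReal_mono Iio_subset_Iic_self

theorem distTransform_le_distFun (ν : ProbabilityMeasure EReal) {x : EReal} {v : ℝ}
    (hv : v ≤ 1) : distTransform ν (x, v) ≤ distFun ν x := by
  have := measureReal_Iio_le_distFun ν x
  simp only [distTransform]
  nlinarith

theorem measureReal_Iio_le_distTransform (ν : ProbabilityMeasure EReal) {x : EReal} {v : ℝ}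
    (hv : 0 ≤ v) : (ν : Measure EReal).real (Iio x) ≤ distTransform ν (x, v) := by
  have := measureReal_Iio_le_distFun ν x
  simp only [distTransform]
  nlinarith

/-- Continuity from below along a sequence increasing to `x`; `0 ≤ t` covers `x = ⊥`, where `Iio x`
is empty. -/
theorem measureReal_Iio_le_of_forall_lt (ν : ProbabilityMeasure EReal) {x : EReal} {t : ℝ}
    (ht : 0 ≤ t) (h : ∀ y < x, distFun ν y ≤ t) : (ν : Measure EReal).real (Iio x) ≤ t := by
  rcases eq_bot_or_bot_lt x with rfl | hx
  · simpa using ht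
  obtain ⟨y, hy, hmem, hlim⟩ := exists_seq_strictMono_tendsto' hx
  have hU : Iio x = ⋃ n, Iic (y n) := by
    refine Subset.antisymm (fun z hz => ?_) (iUnion_subset fun n z hz => hz.trans_lt (hmem n).2)
    obtain ⟨n, hn⟩ := (hlim.eventually (lt_mem_nhds hz)).exists
    exact mem_iUnion.2 ⟨n, hn.le⟩
  have := tendsto_measure_iUnion_atTop (μ := (ν : Measure EReal)) (s := fun n => Iic (y n))
    fun a b hab => Iic_subset_Iic.2 (hy.monotone hab)
  rw [← hU] at this
  exact le_of_tendsto' ((ENNReal.tendsto_toReal (measure_ne_top _ _)).comp this)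
    fun n => h _ (hmem n).2

/-- At each level `t` there is a point where the distribution function crosses `t`, and `t`
divides the jump there in some proportion `c`. -/
theorem exists_crossing (ν : ProbabilityMeasure EReal) {t : ℝ} (h0 : 0 ≤ t) (h1 : t ≤ 1) :
    ∃ x c, (ν : Measure EReal).real (Iio x) ≤ t ∧ t ≤ distFun ν x ∧ 0 ≤ c ∧ c ≤ 1 ∧
      (ν : Measure EReal).real (Iio x) + (distFun ν x - (ν : Measure EReal).real (Iio x)) * c
        = t := by
  have ht : (t : EReal) ≤ 1 := by exact_mod_cast h1
  have hx : (ν : Measure EReal).real (Iio (quantile ν t)) ≤ t := by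
    refine measureReal_Iio_le_of_forall_lt ν h0 fun y hy => ?_
    have := (quantile_le_iff ν ht y).not.1 (not_le.2 hy)
    exact (EReal.coe_lt_coe_iff.1 (not_le.1 this)).le
  have hx' : t ≤ distFun ν (quantile ν t) :=
    EReal.coe_le_coe_iff.1 ((quantile_le_iff ν ht _).1 le_rfl)
  generalize quantile ν t = x at hx hx'
  rcases (hx.trans hx').eq_or_lt with h | h
  · exact ⟨x, 0, hx, hx', le_rfl, zero_le_one, by linarith⟩
  · refine ⟨x, (t - (ν : Measure EReal).real (Iio x)) /
      (distFun ν x - (ν : Measure EReal).real (Iio x)), hx, hx', ?_, ?_, ?_⟩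
    · exact div_nonneg (by linarith) (by linarith)
    · rw [div_le_one (by linarith)]; linarith
    · rw [mul_div_cancel₀ _ (sub_pos.2 h).ne']; ring

theorem ae_snd_mem_Icc {E : Type*} [MeasurableSpace E] (μ : Measure E) [SFinite μ] :
    ∀ᵐ p ∂(μ.prod unitMeasure), p.2 ∈ Icc (0 : ℝ) 1 :=
  Measure.quasiMeasurePreserving_snd.ae (ae_restrict_mem measurableSet_Icc)

theorem measureReal_Icc_restrict {c : ℝ} (h0 : 0 ≤ c) (h1 : c ≤ 1) :
    unitMeasure.real (Icc 0 c) = c := by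
  rw [measureReal_restrict_apply measurableSet_Icc,
    inter_eq_self_of_subset_left (Icc_subset_Icc_right h1)]
  simp [h0]

theorem measureReal_Ico_restrict {c : ℝ} (h0 : 0 ≤ c) (h1 : c ≤ 1) :
    unitMeasure.real (Ico 0 c) = c := by
  rw [measureReal_restrict_apply measurableSet_Ico,
    inter_eq_self_of_subset_left (Ico_subset_Icc_self.trans (Icc_subset_Icc_right h1))]
  simp [h0]

theorem measureReal_singleton_eq_sub (ν : ProbabilityMeasure EReal) (x : EReal) :
    (ν : Measure EReal).real {x} = distFun ν x - (ν : Measure EReal).real (Iio x) := by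
  rw [distFun, ← Iio_union_right, measureReal_union (by simp) (measurableSet_singleton x)]
  ring

theorem measureReal_Iio_prod_union (ν : ProbabilityMeasure EReal) (x : EReal) {s : Set ℝ}
    (hs : MeasurableSet s) :
    ((ν : Measure EReal).prod unitMeasure).real (Iio x ×ˢ univ ∪ {x} ×ˢ s) =
      (ν : Measure EReal).real (Iio x) +
        (distFun ν x - (ν : Measure EReal).real (Iio x)) * unitMeasure.real s := by
  rw [measureReal_union _ ((measurableSet_singleton x).prod hs), measureReal_prod_prod,
    measureReal_prod_prod, measureReal_singleton_eq_sub, probReal_univ, mul_one]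
  rw [Set.disjoint_left]
  rintro ⟨y, v⟩ ⟨h, -⟩ ⟨h', -⟩
  exact (ne_of_lt h) h'

/-- Up to a null set the event contains everything left of the crossing point together with the
fraction `c` of the fibre over it, and this region has mass exactly `t`. -/
theorem le_measureReal_distTransform_le (ν : ProbabilityMeasure EReal) {t : ℝ}
    (h0 : 0 ≤ t) (h1 : t ≤ 1) :
    t ≤ ((ν : Measure EReal).prod unitMeasure).real {p | distTransform ν p ≤ t} := by
  obtain ⟨x, c, hx, hx', hc0, hc1, hc⟩ := exists_crossing ν h0 h1
  calc t = ((ν : Measure EReal).prod unitMeasure).real (Iio x ×ˢ univ ∪ {x} ×ˢ Icc 0 c) := by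
        rw [measureReal_Iio_prod_union ν x measurableSet_Icc, measureReal_Icc_restrict hc0 hc1, hc]
    _ ≤ _ := by
        refine ENNReal.toReal_mono (measure_ne_top _ _) (measure_mono_ae ?_)
        filter_upwards [ae_snd_mem_Icc (ν : Measure EReal)]
        rintro ⟨y, v⟩ hv (⟨hy, -⟩ | ⟨hy, hv'⟩)
        · refine (distTransform_le_distFun ν hv.2).trans (le_trans ?_ hx)
          exact measureReal_mono (Iic_subset_Iio.2 hy)
        · obtain rfl : y = x := hy
          change distTransform ν (y, v) ≤ t
          have := hv'.2
          simp only [distTransform]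
          nlinarith

theorem measureReal_distTransform_lt_le (ν : ProbabilityMeasure EReal) {t : ℝ}
    (h0 : 0 ≤ t) (h1 : t ≤ 1) :
    ((ν : Measure EReal).prod unitMeasure).real {p | distTransform ν p < t} ≤ t := by
  obtain ⟨x, c, hx, hx', hc0, hc1, hc⟩ := exists_crossing ν h0 h1
  calc ((ν : Measure EReal).prod unitMeasure).real {p | distTransform ν p < t}
      ≤ ((ν : Measure EReal).prod unitMeasure).real (Iio x ×ˢ univ ∪ {x} ×ˢ Ico 0 c) := by
        refine ENNReal.toReal_mono (measure_ne_top _ _) (measure_mono_ae ?_)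
        filter_upwards [ae_snd_mem_Icc (ν : Measure EReal)]
        rintro ⟨y, v⟩ hv (hp : distTransform ν (y, v) < t)
        rcases lt_trichotomy y x with hy | rfl | hy
        · exact Or.inl ⟨hy, mem_univ _⟩
        · refine Or.inr ⟨rfl, hv.1, ?_⟩
          simp only [distTransform] at hp
          by_contra! hcv
          have := measureReal_Iio_le_distFun ν y
          have : c ≤ v := hcv
          nlinarith
        -- To the right of the crossing point the transform is at least `ν (Iio y) ≥ F(x) ≥ t`.
        · refine absurd hp (not_lt.2 (hx'.trans (le_trans ?_
            (measureReal_Iio_le_distTransform ν hv.1))))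
          exact measureReal_mono (Iic_subset_Iio.2 hy)
    _ = t := by
        rw [measureReal_Iio_prod_union ν x measurableSet_Ico, measureReal_Ico_restrict hc0 hc1, hc]

/-- The distributional transform of a random variable is uniformly distributed on `[0,1]`. -/
theorem map_distTransform (ν : ProbabilityMeasure EReal) :
    ((ν : Measure EReal).prod unitMeasure).map (fun p => (distTransform ν p : EReal)) = uniformUnit := by
  have hm := distTransform_measurable ν
  rw [uniformUnit, ← Function.comp_def (fun x : ℝ => (x : EReal)),
    ← Measure.map_map measurable_coe_real_ereal hm]
  congr 1
  have : IsProbabilityMeasure (((ν : Measure EReal).prod unitMeasure).map (distTransform ν)) :=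
    Measure.isProbabilityMeasure_map hm.aemeasurable
  have key : ∀ t : ℝ, 0 ≤ t → t ≤ 1 →
      ((ν : Measure EReal).prod unitMeasure).real {p | distTransform ν p ≤ t} = t := by
    intro t h0 h1
    refine le_antisymm ?_ (le_measureReal_distTransform_le ν h0 h1)
    rcases h1.eq_or_lt with rfl | h1
    · exact measureReal_le_one
    -- The upper bound is available only for strict events, so `{T ≤ t}` is enclosed in `{T < s}`
    -- and `s` decreases to `t`.
    refine le_of_forall_gt_imp_ge_of_dense fun s hs => ?_
    rcases le_total 1 s with h | h
    · exact measureReal_le_one.trans h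
    · exact (measureReal_mono fun p (hp : distTransform ν p ≤ t) => hp.trans_lt hs).trans
        (measureReal_distTransform_lt_le ν (h0.trans hs.le) h)
  have hall : ∀ t : ℝ, (((ν : Measure EReal).prod unitMeasure).map (distTransform ν)).real (Iic t) =
      unitMeasure.real (Iic t) := by
    intro t
    rw [map_measureReal_apply hm measurableSet_Iic]
    have hIcc : unitMeasure.real (Iic t) = max 0 (min t 1) := by
      have : Iic t ∩ Icc 0 1 = Icc 0 (min t 1) := by
        ext v
        simp only [mem_inter_iff, mem_Iic, mem_Icc, le_min_iff]
        tauto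
      rw [measureReal_restrict_apply measurableSet_Iic, this, Real.volume_real_Icc]
      simp [max_comm]
    rw [hIcc]
    rcases le_total t 0 with h | h
    · rcases h.eq_or_lt with rfl | h
      · rw [min_eq_left zero_le_one, max_self]
        exact key 0 le_rfl zero_le_one
      rw [max_eq_left ((min_le_left _ _).trans h.le)]
      refine le_antisymm ?_ measureReal_nonneg
      exact (measureReal_mono fun p (hp : distTransform ν p ≤ t) => hp.trans h.le).trans
        (key 0 le_rfl zero_le_one).le
    rcases le_total t 1 with h' | h'
    · rw [min_eq_left h', max_eq_right h]
      exact key t h h'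
    · rw [min_eq_right h', max_eq_right zero_le_one]
      refine le_antisymm measureReal_le_one ?_
      exact (key 1 zero_le_one le_rfl).symm.le.trans
        (measureReal_mono fun p (hp : distTransform ν p ≤ 1) => hp.trans h')
  exact Measure.ext_of_Iic _ _ fun t =>
    (ENNReal.toReal_eq_toReal_iff' (measure_ne_top _ _) (measure_ne_top _ _)).1 (hall t)

variable {I : Type*}

theorem distTransformMap_measurable (ν : I → ProbabilityMeasure EReal) :
    Measurable fun (p : (I → EReal) × ℝ) (i : I) => (distTransform (ν i) (p.1 i, p.2) : EReal) :=
  measurable_pi_lambda _ fun i => measurable_coe_real_ereal.comp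
    ((distTransform_measurable (ν i)).comp
      (((measurable_pi_apply i).comp measurable_fst).prodMk measurable_snd))

/-- The joint law of the distributional transforms of the coordinates. -/
noncomputable def Law.transform (μ : Law I) : Law I :=
  (⟨(μ.toMeasure.prod unitMeasure).map
    fun p i => (distTransform (μ.marginal i) (p.1 i, p.2) : EReal),
    Measure.isProbabilityMeasure_map (distTransformMap_measurable μ.marginal).aemeasurable⟩ :
      ProbabilityMeasure (I → EReal))

theorem Law.toMeasure_transform (μ : Law I) :
    μ.transform.toMeasure = (μ.toMeasure.prod unitMeasure).map
      fun p i => (distTransform (μ.marginal i) (p.1 i, p.2) : EReal) := rfl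

/-- A single coordinate paired with the randomizer has law `μ_i ⊗ uniform`, so `map_distTransform`
applies. -/
theorem Law.isCopula_transform (μ : Law I) : IsCopula μ.transform := by
  intro i
  rw [Law.toMeasure_marginal, Law.toMeasure_transform,
    Measure.map_map (measurable_pi_apply i) (distTransformMap_measurable _),
    ← map_distTransform (μ.marginal i), Law.toMeasure_marginal,
    show (μ.toMeasure.map fun y => y i).prod unitMeasure =
      (μ.toMeasure.prod unitMeasure).map (Prod.map (fun y => y i) id) by
        rw [← Measure.map_prod_map _ _ (measurable_pi_apply i) measurable_id, Measure.map_id],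
    Measure.map_map (g := fun p => (distTransform (μ.marginal i) p : EReal))
      (measurable_coe_real_ereal.comp (distTransform_measurable _))
      ((measurable_pi_apply i).prodMap measurable_id)]
  rfl

/-- The coordinate events of a law and of its transform agree almost surely. -/
theorem Law.ae_distTransform_le_iff (μ : Law I) (i : I) (x : EReal) :
    ∀ᵐ p ∂(μ.toMeasure.prod unitMeasure),
      (distTransform (μ.marginal i) (p.1 i, p.2) : EReal) ≤ (distFun (μ.marginal i) x : EReal) ↔
        p.1 i ≤ x := by
  have hA : MeasurableSet {p : (I → EReal) × ℝ | p.1 i ≤ x} :=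
    measurableSet_le ((measurable_pi_apply i).comp measurable_fst) measurable_const
  -- One inclusion holds almost surely; as both events have probability `F(x)`, they agree up to a
  -- null set.
  have hsub : {p : (I → EReal) × ℝ | p.1 i ≤ x} ≤ᵐ[μ.toMeasure.prod unitMeasure]
      {p | (distTransform (μ.marginal i) (p.1 i, p.2) : EReal) ≤
        (distFun (μ.marginal i) x : EReal)} := by
    filter_upwards [ae_snd_mem_Icc μ.toMeasure] with p hp (hpx : p.1 i ≤ x)
    exact EReal.coe_le_coe_iff.2
      ((distTransform_le_distFun _ hp.2).trans (distFun_mono _ hpx))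
  have h1 : (μ.toMeasure.prod unitMeasure).real {p | p.1 i ≤ x} = distFun (μ.marginal i) x := by
    rw [Law.distFun_marginal, ← (measurePreserving_fst (μ := μ.toMeasure) (ν := unitMeasure)).measureReal_preimage
      (measurableSet_le (measurable_pi_apply i) measurable_const).nullMeasurableSet]
    rfl
  have h2 : (μ.toMeasure.prod unitMeasure).real
      {p | (distTransform (μ.marginal i) (p.1 i, p.2) : EReal) ≤
        (distFun (μ.marginal i) x : EReal)} = distFun (μ.marginal i) x := by
    refine Eq.trans ?_ (uniformUnit_real_Iic (distFun_nonneg (μ.marginal i) x)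
      (distFun_le_one _ x))
    rw [← μ.isCopula_transform i, Law.toMeasure_marginal, Law.toMeasure_transform,
      map_measureReal_apply (measurable_pi_apply i) measurableSet_Iic,
      map_measureReal_apply (distTransformMap_measurable _)
        (measurable_pi_apply i measurableSet_Iic)]
    rfl
  have := ae_eq_of_ae_subset_of_measure_ge hsub
    ((ENNReal.toReal_le_toReal (measure_ne_top _ _) (measure_ne_top _ _)).1 (h2.trans h1.symm).le)
    hA.nullMeasurableSet (measure_ne_top _ _)
  filter_upwards [this] with p hp
  exact (iff_of_eq hp).symm

theorem Law.sklarIdentity_transform (μ : Law I) :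
    SklarIdentity μ.transform μ.marginal μ := by
  intro J x
  rw [Law.distFun_fdd, Law.distFun_fdd, Law.toMeasure_transform,
    map_measureReal_apply (distTransformMap_measurable _) (measurableSet_forall_le _),
    ← (measurePreserving_fst (μ := μ.toMeasure) (ν := unitMeasure)).measureReal_preimage
      (measurableSet_forall_le x).nullMeasurableSet]
  refine measureReal_congr ?_
  filter_upwards [ae_all_iff.2 fun j : J => μ.ae_distTransform_le_iff j (x j)] with p hp
  exact propext (forall_congr' hp)

end Existence

/-! ### Stability of the Sklar identity and continuity of `sklarMap`. -/

section Continuity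

theorem ProbabilityMeasure.tendsto_distFun_of_frontier {E ι : Type*} [Preorder E]
    [TopologicalSpace E] [MeasurableSpace E] [OpensMeasurableSpace E] [HasOuterApproxClosed E]
    {l : Filter ι} {μ : ι → ProbabilityMeasure E} {μ₀ : ProbabilityMeasure E}
    (h : Tendsto μ l (𝓝 μ₀)) {x : E} (hx : (μ₀ : Measure E) (frontier (Iic x)) = 0) :
    Tendsto (fun k => distFun (μ k) x) l (𝓝 (distFun μ₀ x)) :=
  (ENNReal.tendsto_toReal (measure_ne_top _ _)).comp
    (ProbabilityMeasure.tendsto_measure_of_null_frontier_of_tendsto' h hx)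

theorem frontier_Iic_pi_subset {J : Type*} [Finite J] (x : J → EReal) :
    frontier (Iic x) ⊆ ⋃ j, (fun y : J → EReal => y j) ⁻¹' frontier (Iic (x j)) := by
  intro y hy
  rw [← pi_univ_Iic, (isClosed_set_pi fun j _ => isClosed_Iic).frontier_eq,
    interior_pi_set finite_univ] at hy
  obtain ⟨h1, h2⟩ := hy
  simp only [mem_univ_pi, not_forall] at h1 h2
  obtain ⟨j, hj⟩ := h2
  refine mem_iUnion.2 ⟨j, ?_⟩
  rw [mem_preimage, isClosed_Iic.frontier_eq]
  exact ⟨h1 j, hj⟩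

/-- Continuity points of a joint distribution function can thus be chosen one coordinate at a time.
-/
theorem Law.fdd_frontier_Iic {I : Type*} (μ : Law I) {J : Finset I} {x : J → EReal}
    (h : ∀ j : J, (μ.marginal j : Measure EReal) (frontier (Iic (x j))) = 0) :
    (μ.fdd J : Measure (J → EReal)) (frontier (Iic x)) = 0 := by
  refine measure_mono_null (frontier_Iic_pi_subset x) (measure_iUnion_null fun j => ?_)
  have hf : MeasurableSet (frontier (Iic (x j))) := isClosed_frontier.measurableSet
  rw [Law.toMeasure_fdd, Measure.map_apply (Finset.measurable_restrict J)
    (measurable_pi_apply j hf)]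
  rw [← h j, Law.toMeasure_marginal, Measure.map_apply (measurable_pi_apply (j : I)) hf]
  rfl

theorem EReal.dense_compl_of_countable {s : Set EReal} (hs : s.Countable) : Dense sᶜ := by
  have h1 : Dense ((fun x : ℝ => (x : EReal)) ⁻¹' s)ᶜ :=
    (hs.preimage EReal.coe_injective).dense_compl ℝ
  have h2 : DenseRange (fun x : ℝ => (x : EReal)) := by
    refine dense_of_exists_between fun a b hab => ?_
    obtain ⟨q, hq⟩ := EReal.lt_iff_exists_real_btwn.1 hab
    exact ⟨q, ⟨q, rfl⟩, hq⟩
  refine (h2.dense_image continuous_coe_real_ereal h1).mono ?_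
  rintro _ ⟨x, hx, rfl⟩
  exact hx

theorem countable_setOf_measure_singleton_ne_zero (μ : Measure EReal) [SFinite μ] :
    {x | μ {x} ≠ 0}.Countable := by
  simp only [← pos_iff_ne_zero]
  exact Measure.countable_meas_pos_of_disjoint_iUnion (As := fun x : EReal => {x})
    (fun x => measurableSet_singleton x) fun x y hxy => disjoint_singleton.2 hxy

/-- Every point of `[-∞,∞]` is a limit from the right of continuity points of two given
distribution functions. -/
theorem exists_seq_frontier_Iic_null (μ ν : Measure EReal) [SFinite μ] [SFinite ν] (x : EReal) :
    ∃ y : ℕ → EReal, (∀ n, x ≤ y n) ∧ Tendsto y atTop (𝓝 x) ∧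
      ∀ n, μ (frontier (Iic (y n))) = 0 ∧ ν (frontier (Iic (y n))) = 0 := by
  rcases eq_top_or_lt_top x with rfl | hx
  -- `Iic ⊤` is the whole space and has empty frontier, so an atom at `⊤` does no harm.
  · exact ⟨fun _ => ⊤, fun _ => le_rfl, tendsto_const_nhds, by simp⟩
  have hd := EReal.dense_compl_of_countable
    ((countable_setOf_measure_singleton_ne_zero μ).union
      (countable_setOf_measure_singleton_ne_zero ν))
  have hcl : x ∈ closure (Ioi x ∩ ({x | μ {x} ≠ 0} ∪ {x | ν {x} ≠ 0})ᶜ) := by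
    refine closure_minimal (hd.open_subset_closure_inter isOpen_Ioi) isClosed_closure ?_
    rw [closure_Ioi' ⟨⊤, hx⟩]
    exact self_mem_Ici
  obtain ⟨y, hy, hlim⟩ := mem_closure_iff_seq_limit.1 hcl
  refine ⟨y, fun n => (hy n).1.le, hlim, fun n => ?_⟩
  have h := (hy n).2
  simp only [mem_compl_iff, mem_union, mem_ofPred_eq, not_or, not_not] at h
  exact ⟨measure_mono_null (frontier_Iic_subset _) h.1,
    measure_mono_null (frontier_Iic_subset _) h.2⟩

variable {I : Type*}

/-- The difference of the two lower orthants is covered by the strips `v j < y j ≤ u j`, and each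
strip has mass at most `|u j - v j|` because the marginals are uniform. -/
theorem IsCopula.distFun_sub_le {C : Law I} (hC : IsCopula C) (J : Finset I) (u v : J → ℝ) :
    distFun (C.fdd J) (fun j => (u j : EReal)) - distFun (C.fdd J) (fun j => (v j : EReal)) ≤
      ∑ j, |u j - v j| := by
  rw [Law.distFun_fdd, Law.distFun_fdd]
  have hsub : {y : I → EReal | ∀ j : J, y j ≤ u j} \ {y | ∀ j : J, y j ≤ v j} ⊆
      ⋃ j : J, {y | y j ∈ Ioc (v j : EReal) (u j)} := by
    rintro y ⟨h1, h2⟩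
    simp only [mem_ofPred_eq, not_forall, not_le] at h1 h2
    obtain ⟨j, hj⟩ := h2
    exact mem_iUnion.2 ⟨j, hj, h1 j⟩
  have hle (j : J) : C.toMeasure.real {y | y j ∈ Ioc (v j : EReal) (u j)} ≤ |u j - v j| := by
    have : C.toMeasure {y | y j ∈ Ioc (v j : EReal) (u j)} = uniformUnit (Ioc (v j) (u j)) := by
      rw [← hC j, Law.toMeasure_marginal, Measure.map_apply (measurable_pi_apply _)
        measurableSet_Ioc]
      rfl
    rw [Measure.real, this]
    refine ENNReal.toReal_le_of_le_ofReal (abs_nonneg _) ((uniformUnit_Ioc_le _ _).trans ?_)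
    exact ENNReal.ofReal_le_ofReal (le_abs_self _)
  calc _ ≤ C.toMeasure.real ({y : I → EReal | ∀ j : J, y j ≤ u j} \ {y | ∀ j : J, y j ≤ v j}) :=
        le_measureReal_sdiff
    _ ≤ C.toMeasure.real (⋃ j : J, {y | y j ∈ Ioc (v j : EReal) (u j)}) := measureReal_mono hsub
    _ ≤ ∑ j : J, C.toMeasure.real {y | y j ∈ Ioc (v j : EReal) (u j)} :=
        measureReal_iUnion_fintype_le _
    _ ≤ _ := Finset.sum_le_sum fun j _ => hle j

/-- Distribution functions of copula measures are 1-Lipschitz for the sum of the coordinate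
distances. -/
theorem IsCopula.abs_distFun_sub_le {C : Law I} (hC : IsCopula C) (J : Finset I) (u v : J → ℝ) :
    |distFun (C.fdd J) (fun j => (u j : EReal)) - distFun (C.fdd J) (fun j => (v j : EReal))| ≤
      ∑ j, |u j - v j| := by
  refine abs_sub_le_iff.2 ⟨hC.distFun_sub_le J u v, ?_⟩
  simpa only [abs_sub_comm] using hC.distFun_sub_le J v u

/-- Joint continuity of the distribution function of a copula measure in measure and argument. -/
theorem tendsto_distFun_copula {ι : Type*} {l : Filter ι} {C : ι → Copula I} {C₀ : Copula I}
    (hC : Tendsto C l (𝓝 C₀)) (J : Finset I) {u : ι → J → ℝ} {u₀ : J → ℝ}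
    (hu : ∀ j, Tendsto (fun k => u k j) l (𝓝 (u₀ j))) :
    Tendsto (fun k => distFun ((C k).1.fdd J) fun j => (u k j : EReal)) l
      (𝓝 (distFun (C₀.1.fdd J) fun j => (u₀ j : EReal))) := by
  have h1 : Tendsto (fun k => distFun ((C k).1.fdd J) fun j => (u₀ j : EReal)) l
      (𝓝 (distFun (C₀.1.fdd J) fun j => (u₀ j : EReal))) := by
    -- The uniform marginals have no atoms, so every point is a continuity point of the limit
    -- copula.
    refine ProbabilityMeasure.tendsto_distFun_of_frontier
      (((Law.continuous_fdd J).comp continuous_subtype_val).continuousAt.tendsto.comp hC)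
      (Law.fdd_frontier_Iic _ fun j => ?_)
    rw [C₀.2 j]
    exact measure_mono_null (frontier_Iic_subset _) (measure_singleton _)
  have h2 : Tendsto (fun k => ∑ j, |u k j - u₀ j|) l (𝓝 0) := by
    have : Tendsto (fun k => ∑ j, |u k j - u₀ j|) l (𝓝 (∑ j : J, |u₀ j - u₀ j|)) :=
      tendsto_finsetSum _ fun j _ => ((hu j).sub_const _).abs
    simpa using this
  have h3 := squeeze_zero_norm (f := fun k => distFun ((C k).1.fdd J) (fun j => (u k j : EReal)) -
    distFun ((C k).1.fdd J) fun j => (u₀ j : EReal)) (fun k => (C k).2.abs_distFun_sub_le J (u k) u₀) h2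
  simpa using h3.add h1

/-- The Sklar identity is preserved under limits. -/
theorem SklarIdentity.of_tendsto {ι : Type*} {l : Filter ι} [l.NeBot] {C : ι → Copula I}
    {C₀ : Copula I} {ν : ι → I → ProbabilityMeasure EReal} {ν₀ : I → ProbabilityMeasure EReal}
    {μ : ι → Law I} {μ₀ : Law I} (hC : Tendsto C l (𝓝 C₀)) (hν : Tendsto ν l (𝓝 ν₀))
    (hμ : Tendsto μ l (𝓝 μ₀)) (h : ∀ k, SklarIdentity (C k).1 (ν k) (μ k)) :
    SklarIdentity C₀.1 ν₀ μ₀ := by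
  intro J x
  -- Weak convergence says nothing at discontinuities. The limit along `l` is therefore taken at
  -- common continuity points of `ν₀ j` and `μ₀.marginal j`, which then decrease to `x j` by right
  -- continuity.
  choose y hxy hlim hnull using fun j : J =>
    exists_seq_frontier_Iic_null (ν₀ j : Measure EReal) (μ₀.marginal j : Measure EReal) (x j)
  have key (n : ℕ) : distFun (C₀.1.fdd J) (fun j => (distFun (ν₀ j) (y j n) : EReal)) =
      distFun (μ₀.fdd J) fun j => y j n := by
    refine tendsto_nhds_unique (tendsto_distFun_copula hC J
      (u := fun k j => distFun (ν k j) (y j n)) fun j => ?_) ?_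
    · exact ProbabilityMeasure.tendsto_distFun_of_frontier (tendsto_pi_nhds.1 hν j)
        (hnull j n).1
    · refine (ProbabilityMeasure.tendsto_distFun_of_frontier
        ((Law.continuous_fdd J).continuousAt.tendsto.comp hμ)
        (Law.fdd_frontier_Iic _ fun j => (hnull j n).2)).congr fun k => ?_
      exact (h k J fun j => y j n).symm
  refine tendsto_nhds_unique (tendsto_distFun_copula (tendsto_const_nhds (x := C₀)) J
    (u := fun n j => distFun (ν₀ j) (y j n)) fun j =>
      tendsto_distFun_of_le _ (hlim j) (hxy j)) ?_
  simp only [key]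
  exact tendsto_distFun_of_le _ (tendsto_pi_nhds.2 hlim) fun n j => hxy j n

/-- Closed graph theorem via ultrafilters: the image ultrafilter converges by compactness, its limit
inherits the Sklar identity, and the identity forces that limit to be the value of the map. -/
theorem continuous_sklarMap (I : Type*) : Continuous (sklarMap I) := by
  refine continuous_iff_ultrafilter.2 fun p U hU => ?_
  have hlim : Tendsto (sklarMap I) U (𝓝 (U.map (sklarMap I)).lim) :=
    (U.map (sklarMap I)).le_nhds_lim
  have hU' : Tendsto id (U : Filter (Copula I × (I → ProbabilityMeasure EReal))) (𝓝 p) := hU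
  have h : SklarIdentity p.1.1 p.2 (U.map (sklarMap I)).lim :=
    SklarIdentity.of_tendsto ((continuous_fst.tendsto p).comp hU')
      ((continuous_snd.tendsto p).comp hU') hlim
      fun q => sklarIdentity_quantilePush q.1.2 q.2
  rw [h.eq_quantilePush p.1.2] at hlim
  exact hlim

end Continuity

theorem mainTheorem2 (I : Type*) :
    -- the topology on laws is the one of the inverse limit, along the natural bijection
    IsHomeomorph (Law.toConsistentFamily : Law I → ConsistentFamily I) ∧
    -- (1) Hausdorff
    T2Space (Law I) ∧
    -- (2) compactness of the space of copula measures
    CompactSpace (Copula I) ∧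
    -- (3) the explicit push-forward has the given marginals and satisfies the Sklar identity
    (∀ (C : Copula I) (ν : I → ProbabilityMeasure EReal),
      (∀ i, (quantilePush C.1 ν).marginal i = ν i) ∧
        SklarIdentity C.1 ν (quantilePush C.1 ν)) ∧
    -- (4) continuity and surjectivity of the map
    Continuous (sklarMap I) ∧
    Function.Surjective (sklarMap I) ∧
    -- Sklar's theorem: existence, uniqueness for continuous marginals, and the converse
    (∀ μ : Law I, ∃ C : Copula I, SklarIdentity C.1 μ.marginal μ) ∧
    (∀ μ : Law I,
      (∀ i, Continuous (distFun (μ.marginal i)) ∧ distFun (μ.marginal i) ⊥ = 0) →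
        ∃! C : Copula I, SklarIdentity C.1 μ.marginal μ) ∧
    (∀ (C : Copula I) (ν : I → ProbabilityMeasure EReal),
      ∃! μ : Law I, SklarIdentity C.1 ν μ) := by
  refine ⟨Law.isHomeomorph_toConsistentFamily, inferInstance, inferInstance,
    fun C ν => ⟨marginal_quantilePush C.2 ν, sklarIdentity_quantilePush C.2 ν⟩,
    continuous_sklarMap I, fun μ => ?_, fun μ => ?_, fun μ hμ => ?_, fun C ν => ?_⟩
  · exact ⟨(⟨μ.transform, μ.isCopula_transform⟩, μ.marginal),
      (μ.sklarIdentity_transform.eq_quantilePush μ.isCopula_transform).symm⟩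
  · exact ⟨⟨μ.transform, μ.isCopula_transform⟩, μ.sklarIdentity_transform⟩
  · exact ⟨⟨μ.transform, μ.isCopula_transform⟩, μ.sklarIdentity_transform, fun C hC =>
      Subtype.ext (hC.copula_unique C.2 μ.isCopula_transform μ.sklarIdentity_transform hμ)⟩
  · exact ⟨quantilePush C.1 ν, sklarIdentity_quantilePush C.2 ν,
      fun μ hμ => SklarIdentity.eq_quantilePush C.2 hμ⟩
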